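/- Let $\mathcal H,\mathcal U,\mathcal Y,\mathcal Z$ be Hilbert spaces over the same field ($\mathbb R$ or $\mathbb C$), let $A$ be the generator of a $C_0$-semigroup $(T(t))_{t\ge 0}$ on $\mathcal H$, let $B\in L(\mathcal U,\mathcal H)$, $C\in L(\mathcal H,\mathcal Y)$, $K\in L(\mathcal U,\mathcal Z)$, $z\in\mathcal H$, $v\in\mathcal U$, and assume that there is $c_K>0$ with $\|Ku\|\ge c_K\|Bu\|$ for all $u\in\mathcal U$. Put $$\ell(x,u)=\|Cx\|^2+\|Ku\|^2+2\operatorname{Re}\langle z,x\rangle+2\operatorname{Re}\langle v,u\rangle ,\qquad x\in\mathcal H,\ u\in\mathcal U,$$ and for $x_0\in\mathcal H$ and $u\in L^2_{\rm loc}([0,\infty),\mathcal U)$ denote by $$x_u(t;x_0)=T(t)x_0+\int_0^tT(t-s)Bu(s)\,ds,\qquad t\ge 0,$$ the mild solution of $\dot x=Ax+Bu$, $x(0)=x_0$. Let $(x_e,u_e)\in\operatorname{dom}A\times\mathcal U$ be a controlled equilibrium, i.e. $Ax_e+Bu_e=0$, let $V:\mathcal H\to\mathbb R$ be a storage function, i.e.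 continuously (real) Fréchet differentiable, and let $\alpha:[0,\infty)\to[0,\infty)$ be continuous and strictly increasing with $\alpha(0)=0$. Then the following are equivalent. (i) The optimal control problem with dynamics $\dot x=Ax+Bu$ and stage cost $\ell$ is strictly pre-dissipative at $(x_e,u_e)$ with storage function $V$ and dissipation rate $\alpha$, i.e. for all $x\in\operatorname{dom}A$ and all $u\in\mathcal U$, $$V'(x)(Ax+Bu)\le \ell(x,u)-\ell(x_e,u_e)-\alpha(\|x-x_e\|).$$ (ii) For all $x_0\in\mathcal H$, all $u\in L^2_{\rm loc}([0,\infty),\mathcal U)$ and all $0\le t_1<t_2$, $$V(x_u(t_2;x_0))-V(x_u(t_1;x_0))\le\int_{t_1}^{t_2}\big[\ell(x_u(t;x_0),u(t))-\ell(x_e,u_e)-\alpha(\|x_u(t;x_0)-x_e\|)\big]\,dt .$$ -/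

import Mathlib

open Filter Topology MeasureTheory
open scoped NNReal

noncomputable section

namespace LQ

/-- A `C₀`-semigroup of bounded `𝕜`-linear operators `T t`, `t ≥ 0`, on `H`.
The values of `T` at negative times are irrelevant. -/
structure C0Semigroup (𝕜 H : Type*) [RCLike 𝕜] [NormedAddCommGroup H]
    [InnerProductSpace 𝕜 H] where
  T : ℝ → H →L[𝕜] H
  map_zero : T 0 = ContinuousLinearMap.id 𝕜 H
  map_add : ∀ s t : ℝ, 0 ≤ s → 0 ≤ t → T (s + t) = (T s).comp (T t)
  tendsto_zero : ∀ x : H, Tendsto (fun t : ℝ => T t x) (𝓝[>] 0) (𝓝 x)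

/-- The (unbounded) operator `A` is the infinitesimal generator of `S`: its domain consists of
exactly those `x` for which `(S t x - x) / t` converges as `t ↓ 0`, and `A x` is this limit. -/
def IsGenerator {𝕜 H : Type*} [RCLike 𝕜] [NormedAddCommGroup H] [InnerProductSpace 𝕜 H]
    [NormedSpace ℝ H] (A : H →ₗ.[𝕜] H) (S : C0Semigroup 𝕜 H) : Prop :=
  ∀ x y : H, (x, y) ∈ A.graph ↔
    Tendsto (fun t : ℝ => t⁻¹ • (S.T t x - x)) (𝓝[>] 0) (𝓝 y)

/-- The data of a generalized linear-quadratic optimal control problem: the dynamics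
`x' = A x + B u`, where `A` generates a `C₀`-semigroup, and the coefficients `C, K, z, v` of the
stage cost, subject to `‖K u‖ ≥ c_K ‖B u‖` for some `c_K > 0`. -/
structure OCP (𝕜 H U Y Z : Type*) [RCLike 𝕜]
    [NormedAddCommGroup H] [InnerProductSpace 𝕜 H] [NormedSpace ℝ H]
    [NormedAddCommGroup U] [InnerProductSpace 𝕜 U]
    [NormedAddCommGroup Y] [InnerProductSpace 𝕜 Y]
    [NormedAddCommGroup Z] [InnerProductSpace 𝕜 Z] where
  A : H →ₗ.[𝕜] H
  S : C0Semigroup 𝕜 H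
  isGenerator : IsGenerator A S
  B : U →L[𝕜] H
  C : H →L[𝕜] Y
  K : U →L[𝕜] Z
  z : H
  v : U
  bound_KB : ∃ cK : ℝ, 0 < cK ∧ ∀ u : U, cK * ‖B u‖ ≤ ‖K u‖

/-- The comparison functions of class `𝒦`: continuous, strictly increasing, zero at zero. -/
structure ClassK (α : ℝ≥0 → ℝ≥0) : Prop where
  continuous : Continuous α
  strictMono : StrictMono α
  map_zero : α 0 = 0

/-- A storage function is a real-valued function that is `C¹` in the real Fréchet sense. -/
def IsStorageFunction {H : Type*} [NormedAddCommGroup H] [NormedSpace ℝ H] (V : H → ℝ) : Prop :=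
  ContDiff ℝ 1 V

/-- `u ∈ L²_loc([0,∞), U)`; the values of `u` at negative times are irrelevant. -/
def IsL2Loc {U : Type*} [NormedAddCommGroup U] (u : ℝ → U) : Prop :=
  ∀ τ : ℝ, MemLp u 2 (volume.restrict (Set.Icc 0 τ))

namespace OCP

variable {𝕜 H U Y Z : Type*} [RCLike 𝕜]
  [NormedAddCommGroup H] [InnerProductSpace 𝕜 H] [NormedSpace ℝ H]
  [NormedAddCommGroup U] [InnerProductSpace 𝕜 U]
  [NormedAddCommGroup Y] [InnerProductSpace 𝕜 Y]
  [NormedAddCommGroup Z] [InnerProductSpace 𝕜 Z]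

/-- The stage cost `ℓ(x,u) = ‖Cx‖² + ‖Ku‖² + 2 Re⟨z,x⟩ + 2 Re⟨v,u⟩`. -/
def cost (P : OCP 𝕜 H U Y Z) (x : H) (u : U) : ℝ :=
  ‖P.C x‖ ^ 2 + ‖P.K u‖ ^ 2 + 2 * RCLike.re (inner 𝕜 P.z x) + 2 * RCLike.re (inner 𝕜 P.v u)

/-- `(xₑ, uₑ) ∈ dom A × U` with `A xₑ + B uₑ = 0`. -/
def IsControlledEquilibrium (P : OCP 𝕜 H U Y Z) (xe : H) (ue : U) : Prop :=
  ∃ hx : xe ∈ P.A.domain, P.A ⟨xe, hx⟩ + P.B ue = 0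

/-- The mild solution `x_u(t; x₀) = T(t) x₀ + ∫₀ᵗ T(t-s) B u(s) ds` (for `t ≥ 0`). -/
def mildSolution (P : OCP 𝕜 H U Y Z) (u : ℝ → U) (x₀ : H) (t : ℝ) : H :=
  P.S.T t x₀ + ∫ s in (0 : ℝ)..t, P.S.T (t - s) (P.B (u s))

/-- Strict pre-dissipativity at the controlled equilibrium `(xₑ, uₑ)` with the storage function
`V` and the dissipation rate `α`. -/
structure IsStrictlyPreDissipativeWith (P : OCP 𝕜 H U Y Z) (xe : H) (ue : U)
    (V : H → ℝ) (α : ℝ≥0 → ℝ≥0) : Prop where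
  equilibrium : P.IsControlledEquilibrium xe ue
  storage : IsStorageFunction V
  rate : ClassK α
  dissipation : ∀ (x : P.A.domain) (u : U),
    fderiv ℝ V x (P.A x + P.B u) ≤
      P.cost x u - P.cost xe ue - (α ‖(x : H) - xe‖₊ : ℝ)

end OCP

end LQ

end

/-!
The averages `avg h = h⁻¹ ∫₀ʰ T s ds` map `H` into `dom A`, with `A (avg h y) = h⁻¹ (T h y - y)`,
and they commute with the semigroup. Applied to a mild solution `x` of `x' = A x + B u` they
therefore give a function `xₕ` with values in `dom A` and integrable derivative
`A xₕ + avg h (B u)`, along which `V` is absolutely continuous. Dissipativity at `(xₕ t, u t)`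
bounds the derivative of `V ∘ xₕ` by the rate plus `V'(xₕ) (avg h (B u) - B u)`, and the integrated
inequality for `x` follows by dominated convergence as `h ↓ 0`.

Conversely, for `x ∈ dom A` and a constant control the mild solution is differentiable from the
right at `0` with derivative `A x + B u`, and dividing the integrated inequality over `[0, t]` by
`t` gives the pointwise one.
-/

namespace LQ

/-! ### Primitives -/

theorem absolutelyContinuousOnInterval_of_dist_le {X Y : Type*} [PseudoMetricSpace X]
    [PseudoMetricSpace Y] {f : ℝ → X} {g : ℝ → Y} {a b : ℝ}
    (hg : AbsolutelyContinuousOnInterval g a b)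
    (hfg : ∀ s ∈ Set.uIcc a b, ∀ t ∈ Set.uIcc a b, dist (f s) (f t) ≤ dist (g s) (g t)) :
    AbsolutelyContinuousOnInterval f a b := by
  rw [absolutelyContinuousOnInterval_iff] at hg ⊢
  intro ε hε
  obtain ⟨δ, hδ, h⟩ := hg ε hε
  refine ⟨δ, hδ, fun I hI hlen => (Finset.sum_le_sum fun i hi => ?_).trans_lt (h I hI hlen)⟩
  exact hfg _ (hI.1 i hi).1 _ (hI.1 i hi).2

section Primitive

variable {E : Type*} [NormedAddCommGroup E] [NormedSpace ℝ E] {V : E → ℝ} {w : ℝ → E} {a b : ℝ}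

theorem absolutelyContinuousOnInterval_comp_primitive (hV : ContDiff ℝ 1 V)
    (hw : IntervalIntegrable w volume a b) (y : E) :
    AbsolutelyContinuousOnInterval (fun t => V (y + ∫ s in a..t, w s)) a b := by
  have hcont : ContinuousOn (fun t => y + ∫ s in a..t, w s) (Set.uIcc a b) :=
    continuousOn_const.add (intervalIntegral.continuousOn_primitive_interval' hw Set.left_mem_uIcc)
  obtain ⟨L, hL⟩ := hV.locallyLipschitz.locallyLipschitzOn.exists_lipschitzOnWith_of_compact
    (isCompact_uIcc.image_of_continuousOn hcont)
  refine absolutelyContinuousOnInterval_of_dist_le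
    ((hw.norm.const_mul L).absolutelyContinuousOnInterval_intervalIntegral Set.left_mem_uIcc)
    fun s hs t ht => ?_
  have hint {r : ℝ} (hr : r ∈ Set.uIcc a b) : IntervalIntegrable w volume a r :=
    hw.mono_set (Set.uIcc_subset_uIcc_left hr)
  calc dist (V (y + ∫ r in a..s, w r)) (V (y + ∫ r in a..t, w r))
      ≤ L * dist (y + ∫ r in a..s, w r) (y + ∫ r in a..t, w r) :=
        hL.dist_le_mul _ (Set.mem_image_of_mem _ hs) _ (Set.mem_image_of_mem _ ht)
    _ = L * ‖∫ r in t..s, w r‖ := by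
        rw [dist_add_left, dist_eq_norm,
          intervalIntegral.integral_interval_sub_left (hint hs) (hint ht)]
    _ ≤ L * |∫ r in t..s, ‖w r‖| := by
        gcongr
        exact intervalIntegral.norm_integral_le_abs_integral_norm
    _ = dist (∫ r in a..s, L * ‖w r‖) (∫ r in a..t, L * ‖w r‖) := by
        rw [Real.dist_eq, intervalIntegral.integral_interval_sub_left
          ((hint hs).norm.const_mul _) ((hint ht).norm.const_mul _),
          intervalIntegral.integral_const_mul, abs_mul, NNReal.abs_eq]

theorem sub_eq_integral_fderiv_comp_primitive [CompleteSpace E] (hV : ContDiff ℝ 1 V)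
    (hw : IntervalIntegrable w volume a b) (y : E) :
    V (y + ∫ s in a..b, w s) - V y =
      ∫ t in a..b, fderiv ℝ V (y + ∫ s in a..t, w s) (w t) := by
  have hftc := (absolutelyContinuousOnInterval_comp_primitive hV hw y).integral_deriv_eq_sub
  simp only [intervalIntegral.integral_same, add_zero] at hftc
  rw [← hftc]
  refine intervalIntegral.integral_congr_ae ?_
  filter_upwards [hw.ae_hasDerivAt_integral] with t ht hmem
  have hderiv := (ht (Set.uIoc_subset_uIcc hmem) a Set.left_mem_uIcc).const_add y
  exact ((hV.differentiable one_ne_zero _).hasFDerivAt.comp_hasDerivAt t hderiv).deriv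

theorem integral_integral_triangle {F : ℝ → ℝ → E} (hab : a ≤ b)
    (hF : IntegrableOn F.uncurry (Set.Ioc a b ×ˢ Set.Ioc a b)) :
    ∫ x in a..b, ∫ y in a..x, F x y = ∫ y in a..b, ∫ x in y..b, F x y := by
  set Δ : Set (ℝ × ℝ) := {p | p.2 ≤ p.1}
  have hΔ : MeasurableSet Δ := measurableSet_le measurable_snd measurable_fst
  set G : ℝ → ℝ → E := fun x y => Δ.indicator F.uncurry (x, y)
  have hG : IntegrableOn G.uncurry (Set.uIoc a b ×ˢ Set.uIoc a b) := by
    rw [Set.uIoc_of_le hab]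
    exact hF.indicator hΔ
  have hleft : ∀ x ∈ Set.uIcc a b, ∫ y in a..x, F x y = ∫ y in a..b, G x y := fun x hx => by
    rw [Set.uIcc_of_le hab] at hx
    exact (intervalIntegral.integral_indicator (f := F x) hx).symm
  have hright : ∀ y ∈ Set.uIcc a b, ∫ x in y..b, F x y = ∫ x in a..b, G x y := fun y hy => by
    rw [Set.uIcc_of_le hab] at hy
    have hGy : (fun x => G x y) = (Set.Ici y).indicator fun x => F x y := rfl
    rw [intervalIntegral.integral_of_le hab, hGy, setIntegral_indicator measurableSet_Ici,
      intervalIntegral.integral_of_le hy.2]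
    have hIoc : Set.Ioc y b = Set.Ioc a b ∩ Set.Ioi y := by
      rw [Set.Ioc_inter_Ioi, max_eq_right hy.1]
    rw [hIoc]
    exact setIntegral_congr_set ((ae_eq_refl _).inter Ioi_ae_eq_Ici)
  rw [intervalIntegral.integral_congr hleft, intervalIntegral.integral_congr hright,
    intervalIntegral_intervalIntegral_swap hG]

end Primitive

theorem le_of_forall_sub_le_integral {g φ : ℝ → ℝ} {a b g' : ℝ} (hab : a < b)
    (hg : HasDerivWithinAt g g' (Set.Ioi a) a) (hφ : ContinuousOn φ (Set.Icc a b))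
    (h : ∀ t ∈ Set.Ioc a b, g t - g a ≤ ∫ s in a..t, φ s) : g' ≤ φ a := by
  have hprim : HasDerivWithinAt (fun t => ∫ s in a..t, φ s) (φ a) (Set.Ici a) a := by
    refine intervalIntegral.integral_hasDerivWithinAt_right .refl (t := Set.Ioi a) ?_ ?_
    · rw [← nhdsWithin_Ioc_eq_nhdsGT hab]
      exact (hφ.mono Set.Ioc_subset_Icc_self).stronglyMeasurableAtFilter_nhdsWithin
        measurableSet_Ioc a
    · exact ((hφ a (Set.left_mem_Icc.2 hab.le)).mono_of_mem_nhdsWithin (Icc_mem_nhdsGE hab)).mono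
        Set.Ioi_subset_Ici_self
  replace hprim := hprim.mono Set.Ioi_subset_Ici_self
  rw [hasDerivWithinAt_iff_tendsto_slope' Set.self_notMem_Ioi] at hg hprim
  refine le_of_tendsto_of_tendsto hg hprim ?_
  filter_upwards [Ioc_mem_nhdsGT hab] with t ht
  rw [slope_def_field, slope_def_field, intervalIntegral.integral_same, sub_zero]
  exact div_le_div_of_nonneg_right (h t ht) (sub_pos.2 ht.1).le

theorem tendsto_inv_smul_integral_zero {E : Type*} [NormedAddCommGroup E] [NormedSpace ℝ E]
    [CompleteSpace E] {φ : ℝ → E} (hφ : Continuous φ) :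
    Tendsto (fun t => t⁻¹ • ∫ s in 0..t, φ s) (𝓝[>] 0) (𝓝 (φ 0)) := by
  simpa using (hφ.integral_hasStrictDerivAt 0 0).hasDerivAt.tendsto_slope_zero_right

/-! ### Semigroup orbits -/

theorem isBoundedUnder_norm_of_tendsto_apply {ι 𝕜 E F : Type*} [NontriviallyNormedField 𝕜]
    [NormedAddCommGroup E] [NormedSpace 𝕜 E] [CompleteSpace E]
    [NormedAddCommGroup F] [NormedSpace 𝕜 F] {l : Filter ι} [l.IsCountablyGenerated]
    {g : ι → E →L[𝕜] F} {y : E → F} (h : ∀ x, Tendsto (fun i => g i x) l (𝓝 (y x))) :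
    l.IsBoundedUnder (· ≤ ·) fun i => ‖g i‖ := by
  by_contra hunbounded
  have hfrequently (n : ℕ) : ∃ᶠ i in l, (n : ℝ) < ‖g i‖ := by
    contrapose! hunbounded
    exact ⟨n, by simpa using hunbounded⟩
  obtain ⟨s, hs⟩ := l.exists_antitone_basis
  choose i hlt hmem using fun n => ((hfrequently n).and_eventually (hs.mem n)).exists
  obtain ⟨C, hC⟩ := banach_steinhaus (g := fun n => g (i n)) fun x => by
    obtain ⟨C, hC⟩ := ((h x).comp (hs.tendsto hmem)).norm.bddAbove_range
    exact ⟨C, fun n => hC ⟨n, rfl⟩⟩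
  obtain ⟨n, hn⟩ := exists_nat_gt C
  exact ((hlt n).trans_le (hC n)).not_gt hn

namespace C0Semigroup

variable {𝕜 H : Type*} [RCLike 𝕜] [NormedAddCommGroup H] [InnerProductSpace 𝕜 H]

theorem T_nat_mul (S : C0Semigroup 𝕜 H) {t : ℝ} (ht : 0 ≤ t) (n : ℕ) :
    S.T (n * t) = S.T t ^ n := by
  induction n with
  | zero => rw [Nat.cast_zero, zero_mul, S.map_zero, pow_zero, ContinuousLinearMap.one_def]
  | succ n ih =>
    rw [Nat.cast_succ, add_one_mul, S.map_add _ _ (by positivity) ht, ih, pow_succ]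
    rfl

section Bounds

variable [CompleteSpace H]

theorem exists_norm_le_near_zero (S : C0Semigroup 𝕜 H) :
    ∃ δ > 0, ∃ M, ∀ t ∈ Set.Icc 0 δ, ‖S.T t‖ ≤ M := by
  obtain ⟨M, hM⟩ := isBoundedUnder_norm_of_tendsto_apply S.tendsto_zero
  obtain ⟨δ, hδ, hδM⟩ := mem_nhdsGT_iff_exists_Ioc_subset.1 (eventually_map.1 hM)
  refine ⟨δ, hδ, max M ‖S.T 0‖, fun t ht => ?_⟩
  rcases ht.1.eq_or_lt with rfl | ht0
  · exact le_max_right _ _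
  · exact le_max_of_le_left (hδM ⟨ht0, ht.2⟩)

theorem exists_norm_le (S : C0Semigroup 𝕜 H) (τ : ℝ) :
    ∃ M, ∀ t ∈ Set.Icc 0 τ, ‖S.T t‖ ≤ M := by
  obtain ⟨δ, hδ, M, hM⟩ := S.exists_norm_le_near_zero
  obtain ⟨n, hn⟩ := exists_nat_ge (τ / δ)
  refine ⟨M ^ (n + 1), fun t ht => ?_⟩
  have hn0 : (0 : ℝ) < (n + 1 : ℕ) := by positivity
  have hmem : t / (n + 1 : ℕ) ∈ Set.Icc 0 δ := by
    refine ⟨div_nonneg ht.1 hn0.le, (div_le_iff₀' hn0).2 (ht.2.trans ?_)⟩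
    rw [div_le_iff₀ hδ] at hn
    push_cast
    linarith
  calc ‖S.T t‖ = ‖S.T (t / (n + 1 : ℕ)) ^ (n + 1)‖ := by
        rw [← S.T_nat_mul hmem.1, mul_div_cancel₀ _ hn0.ne']
    _ ≤ ‖S.T (t / (n + 1 : ℕ))‖ ^ (n + 1) := norm_pow_le' _ n.succ_pos
    _ ≤ M ^ (n + 1) := pow_le_pow_left₀ (norm_nonneg _) (hM _ hmem) _

end Bounds

variable [NormedSpace ℝ H] [IsScalarTower ℝ 𝕜 H]

/-- The semigroup as a family of real-linear operators, extended by the identity to negative times,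
so that its orbits are continuous on the whole line. -/
def flow (S : C0Semigroup 𝕜 H) (t : ℝ) : H →L[ℝ] H :=
  (S.T (max t 0)).restrictScalars ℝ

theorem flow_of_nonneg (S : C0Semigroup 𝕜 H) {t : ℝ} (ht : 0 ≤ t) (x : H) :
    S.flow t x = S.T t x := by
  simp [flow, max_eq_left ht]

theorem flow_of_nonpos (S : C0Semigroup 𝕜 H) {t : ℝ} (ht : t ≤ 0) (x : H) : S.flow t x = x := by
  simp [flow, max_eq_right ht, S.map_zero]

theorem flow_add (S : C0Semigroup 𝕜 H) {s t : ℝ} (hs : 0 ≤ s) (ht : 0 ≤ t) (x : H) :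
    S.flow (s + t) x = S.flow s (S.flow t x) := by
  rw [S.flow_of_nonneg (add_nonneg hs ht), S.flow_of_nonneg hs, S.flow_of_nonneg ht,
    S.map_add s t hs ht, ContinuousLinearMap.comp_apply]

theorem tendsto_flow_zero (S : C0Semigroup 𝕜 H) (x : H) :
    Tendsto (fun t => S.flow t x) (𝓝 0) (𝓝 x) := by
  rw [← nhdsLE_sup_nhdsGT]
  refine Tendsto.sup (tendsto_const_nhds.congr' ?_) ((S.tendsto_zero x).congr' ?_)
  · filter_upwards [self_mem_nhdsWithin] with t (ht : t ≤ 0) using (S.flow_of_nonpos ht x).symm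
  · filter_upwards [self_mem_nhdsWithin] with t (ht : 0 < t) using (S.flow_of_nonneg ht.le x).symm

variable [CompleteSpace H]

theorem exists_norm_flow_le (S : C0Semigroup 𝕜 H) (τ : ℝ) :
    ∃ M, 0 ≤ M ∧ ∀ t ≤ τ, ∀ x, ‖S.flow t x‖ ≤ M * ‖x‖ := by
  obtain ⟨M, hM⟩ := S.exists_norm_le (max τ 0)
  have hle {t : ℝ} (ht : t ≤ τ) : ‖S.T (max t 0)‖ ≤ M :=
    hM _ ⟨le_max_right _ _, max_le_max_right 0 ht⟩
  exact ⟨M, (norm_nonneg _).trans (hle le_rfl),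
    fun t ht x => (S.T (max t 0)).le_of_opNorm_le (hle ht) x⟩

theorem norm_flow_sub_flow_le (S : C0Semigroup 𝕜 H) (τ : ℝ) :
    ∃ M, ∀ s ∈ Set.Icc 0 τ, ∀ t ∈ Set.Icc 0 τ, ∀ x,
      ‖S.flow s x - S.flow t x‖ ≤ M * ‖S.flow |s - t| x - x‖ := by
  obtain ⟨M, -, hM⟩ := S.exists_norm_flow_le τ
  refine ⟨M, fun s hs t ht x => ?_⟩
  wlog hts : t ≤ s generalizing s t
  · rw [norm_sub_rev, abs_sub_comm]
    exact this t ht s hs (le_of_not_ge hts)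
  calc ‖S.flow s x - S.flow t x‖ = ‖S.flow t (S.flow (s - t) x - x)‖ := by
        rw [map_sub, ← S.flow_add ht.1 (sub_nonneg.2 hts), add_sub_cancel]
    _ ≤ M * ‖S.flow |s - t| x - x‖ := by
        rw [abs_of_nonneg (sub_nonneg.2 hts)]
        exact hM t ht.2 _

theorem continuous_flow_apply (S : C0Semigroup 𝕜 H) (x : H) : Continuous fun t => S.flow t x := by
  have hmax : (fun t => S.flow t x) = fun t => S.flow (max t 0) x := by simp [flow]
  refine continuous_iff_continuousAt.2 fun t => ?_
  rw [hmax, ContinuousAt, tendsto_iff_norm_sub_tendsto_zero]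
  obtain ⟨M, hM⟩ := S.norm_flow_sub_flow_le (max (t + 1) 0)
  have hdist : Tendsto (fun s => |max s 0 - max t 0|) (𝓝 t) (𝓝 0) := by
    have hcont : Continuous fun s : ℝ => |max s 0 - max t 0| := by fun_prop
    simpa using hcont.tendsto t
  have hbound : Tendsto (fun s => M * ‖S.flow |max s 0 - max t 0| x - x‖) (𝓝 t) (𝓝 0) := by
    simpa using
      (tendsto_iff_norm_sub_tendsto_zero.1 ((S.tendsto_flow_zero x).comp hdist)).const_mul M
  refine squeeze_zero' (Eventually.of_forall fun _ => norm_nonneg _) ?_ hbound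
  filter_upwards [eventually_lt_nhds (lt_add_one t)] with s hs
  exact hM _ ⟨le_max_right _ _, max_le_max_right 0 hs.le⟩ _
    ⟨le_max_right _ _, max_le_max_right 0 (by linarith)⟩ x

theorem continuous_uncurry_flow (S : C0Semigroup 𝕜 H) :
    Continuous fun p : ℝ × H => S.flow p.1 p.2 := by
  refine continuous_iff_continuousAt.2 fun ⟨t, x⟩ => ?_
  obtain ⟨M, -, hM⟩ := S.exists_norm_flow_le (t + 1)
  have hcont : ContinuousOn (fun p : ℝ × H => S.flow p.1 p.2) (Set.Iio (t + 1) ×ˢ Set.univ) :=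
    continuousOn_prod_of_continuousOn_lipschitzOnWith' _ M.toNNReal
      (fun s hs => (AddMonoidHomClass.lipschitz_of_bound (S.flow s) M (hM s hs.le)).lipschitzOnWith)
      fun y _ => (S.continuous_flow_apply y).continuousOn
  exact hcont.continuousAt ((isOpen_Iio.prod isOpen_univ).mem_nhds ⟨lt_add_one t, Set.mem_univ x⟩)

theorem continuous_flow (S : C0Semigroup 𝕜 H) {X : Type*} [TopologicalSpace X] {r : X → ℝ}
    {y : X → H} (hr : Continuous r) (hy : Continuous y) :
    Continuous fun p => S.flow (r p) (y p) :=
  S.continuous_uncurry_flow.comp (hr.prodMk hy)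

end C0Semigroup

/-! ### Averages over the semigroup -/

namespace C0Semigroup

variable {𝕜 H : Type*} [RCLike 𝕜] [NormedAddCommGroup H] [InnerProductSpace 𝕜 H]
  [NormedSpace ℝ H] [IsScalarTower ℝ 𝕜 H]

/-- The difference quotient `h⁻¹ (T h - 1)`, a bounded approximation of the generator. -/
noncomputable def diffQuot (S : C0Semigroup 𝕜 H) (h : ℝ) : H →L[ℝ] H :=
  h⁻¹ • (S.flow h - 1)

theorem diffQuot_apply (S : C0Semigroup 𝕜 H) (h : ℝ) (y : H) :
    S.diffQuot h y = h⁻¹ • (S.flow h y - y) := rfl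

theorem flow_diffQuot_comm (S : C0Semigroup 𝕜 H) {t h : ℝ} (ht : 0 ≤ t) (hh : 0 ≤ h) (y : H) :
    S.flow t (S.diffQuot h y) = S.diffQuot h (S.flow t y) := by
  rw [diffQuot_apply, diffQuot_apply, map_smul, map_sub, ← S.flow_add ht hh, ← S.flow_add hh ht,
    add_comm]

variable [CompleteSpace H]

/-- The averages `h⁻¹ ∫₀ʰ T s ds` of the semigroup, which map into the domain of the generator.
Written as integrals over `[0, 1]`, they include the identity as the value at `h = 0`. -/
noncomputable def avg (S : C0Semigroup 𝕜 H) (h : ℝ) : H →L[ℝ] H where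
  toFun y := ∫ σ in (0 : ℝ)..1, S.flow (h * σ) y
  map_add' y y' := by
    have hint (w : H) : IntervalIntegrable (fun σ => S.flow (h * σ) w) volume 0 1 :=
      (S.continuous_flow (by fun_prop) continuous_const).intervalIntegrable 0 1
    simp only [_root_.map_add]
    exact intervalIntegral.integral_add (hint y) (hint y')
  map_smul' c y := by
    simp only [map_smul, RingHom.id_apply]
    exact intervalIntegral.integral_smul c _
  cont := intervalIntegral.continuous_parametric_intervalIntegral_of_continuous'
    (S.continuous_flow (by fun_prop) (by fun_prop)) 0 1

theorem avg_apply (S : C0Semigroup 𝕜 H) (h : ℝ) (y : H) :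
    S.avg h y = ∫ σ in (0 : ℝ)..1, S.flow (h * σ) y := rfl

theorem avg_zero_apply (S : C0Semigroup 𝕜 H) (y : H) : S.avg 0 y = y := by
  simp [avg_apply, S.flow_of_nonpos le_rfl]

theorem continuous_avg (S : C0Semigroup 𝕜 H) : Continuous fun p : ℝ × H => S.avg p.1 p.2 :=
  intervalIntegral.continuous_parametric_intervalIntegral_of_continuous'
    (f := fun (p : ℝ × H) (σ : ℝ) => S.flow (p.1 * σ) p.2)
    (S.continuous_flow (by fun_prop) (by fun_prop)) 0 1

theorem tendsto_avg_zero (S : C0Semigroup 𝕜 H) (y : H) :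
    Tendsto (fun h => S.avg h y) (𝓝[>] 0) (𝓝 y) := by
  have hcont : Continuous fun h => S.avg h y :=
    S.continuous_avg.comp (continuous_id.prodMk continuous_const)
  simpa only [avg_zero_apply] using (hcont.tendsto 0).mono_left nhdsWithin_le_nhds

theorem smul_avg (S : C0Semigroup 𝕜 H) (h : ℝ) (y : H) :
    h • S.avg h y = ∫ s in 0..h, S.flow s y := by
  simpa [avg_apply] using
    intervalIntegral.smul_integral_comp_mul_left (a := 0) (b := 1) (S.flow · y) h

theorem flow_avg_comm (S : C0Semigroup 𝕜 H) {t h : ℝ} (ht : 0 ≤ t) (hh : 0 ≤ h) (y : H) :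
    S.flow t (S.avg h y) = S.avg h (S.flow t y) := by
  rw [avg_apply, avg_apply, ← ContinuousLinearMap.intervalIntegral_comp_comm _
    ((S.continuous_flow (by fun_prop) continuous_const).intervalIntegrable 0 1)]
  refine intervalIntegral.integral_congr fun σ hσ => ?_
  rw [Set.uIcc_of_le zero_le_one] at hσ
  have hσ0 : 0 ≤ h * σ := mul_nonneg hh hσ.1
  rw [← S.flow_add ht hσ0, ← S.flow_add hσ0 ht, add_comm]

theorem flow_integral_flow (S : C0Semigroup 𝕜 H) {t h : ℝ} (ht : 0 ≤ t) (hh : 0 ≤ h) (y : H) :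
    S.flow t (∫ s in 0..h, S.flow s y) = ∫ s in t..(t + h), S.flow s y := by
  rw [← ContinuousLinearMap.intervalIntegral_comp_comm _
    ((S.continuous_flow_apply y).intervalIntegrable 0 h)]
  have hshift := intervalIntegral.integral_comp_add_left (a := 0) (b := h) (S.flow · y) t
  rw [add_zero] at hshift
  rw [← hshift]
  refine intervalIntegral.integral_congr fun s hs => ?_
  rw [Set.uIcc_of_le hh] at hs
  exact (S.flow_add ht hs.1 y).symm

theorem flow_avg (S : C0Semigroup 𝕜 H) {t h : ℝ} (ht : 0 ≤ t) (hh : 0 < h) (y : H) :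
    S.flow t (S.avg h y) = S.avg h y + ∫ s in 0..t, S.flow s (S.diffQuot h y) := by
  have hint (a b : ℝ) : IntervalIntegrable (fun s => S.flow s y) volume a b :=
    (S.continuous_flow_apply y).intervalIntegrable a b
  have hdiff : h • ∫ s in 0..t, S.flow s (S.diffQuot h y) =
      (∫ s in h..(h + t), S.flow s y) - ∫ s in 0..t, S.flow s y := by
    rw [← S.flow_integral_flow hh.le ht, ← ContinuousLinearMap.intervalIntegral_comp_comm _
      (hint 0 t), ← intervalIntegral.integral_sub _ (hint 0 t), ← intervalIntegral.integral_smul]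
    · refine intervalIntegral.integral_congr fun s hs => ?_
      rw [Set.uIcc_of_le ht] at hs
      simp only [S.flow_diffQuot_comm hs.1 hh.le]
      rw [diffQuot_apply, smul_inv_smul₀ hh.ne']
    · exact (S.continuous_flow continuous_const (S.continuous_flow_apply y)).intervalIntegrable 0 t
  refine smul_right_injective H hh.ne' ?_
  simp only [smul_add]
  rw [hdiff, ← map_smul, smul_avg, S.flow_integral_flow ht hh.le, add_comm h t, ← add_sub_assoc,
    intervalIntegral.integral_add_adjacent_intervals (hint 0 h) (hint h (t + h)),
    intervalIntegral.integral_interval_sub_left (hint 0 (t + h)) (hint 0 t)]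

theorem avg_mem_graph (S : C0Semigroup 𝕜 H) {A : H →ₗ.[𝕜] H} (hA : IsGenerator A S) {h : ℝ}
    (hh : 0 < h) (y : H) : (S.avg h y, S.diffQuot h y) ∈ A.graph := by
  have hlim := tendsto_inv_smul_integral_zero (S.continuous_flow_apply (S.diffQuot h y))
  rw [S.flow_of_nonpos le_rfl] at hlim
  refine (hA _ _).2 (hlim.congr' ?_)
  filter_upwards [self_mem_nhdsWithin] with t (ht : 0 < t)
  rw [← S.flow_of_nonneg ht.le, S.flow_avg ht.le hh, add_sub_cancel_left]

end C0Semigroup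

/-! ### Mild solutions -/

namespace C0Semigroup

variable {𝕜 H : Type*} [RCLike 𝕜] [NormedAddCommGroup H] [InnerProductSpace 𝕜 H]
  [NormedSpace ℝ H]

/-- The mild solution of `x' = A x + f`, `x(0) = x₀`, at time `t ≥ 0`. -/
noncomputable def mild (S : C0Semigroup 𝕜 H) (x₀ : H) (f : ℝ → H) (t : ℝ) : H :=
  S.T t x₀ + ∫ s in (0 : ℝ)..t, S.T (t - s) (f s)

theorem mild_zero (S : C0Semigroup 𝕜 H) (x₀ : H) (f : ℝ → H) : S.mild x₀ f 0 = x₀ := by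
  simp [mild, S.map_zero]

variable [IsScalarTower ℝ 𝕜 H]

theorem mild_eq_flow (S : C0Semigroup 𝕜 H) (x₀ : H) (f : ℝ → H) {t : ℝ} (ht : 0 ≤ t) :
    S.mild x₀ f t = S.flow t x₀ + ∫ s in 0..t, S.flow (t - s) (f s) := by
  rw [mild, ← S.flow_of_nonneg ht]
  congr 1
  refine intervalIntegral.integral_congr fun s hs => ?_
  rw [Set.uIcc_of_le ht] at hs
  exact (S.flow_of_nonneg (sub_nonneg.2 hs.2) _).symm

theorem mild_const (S : C0Semigroup 𝕜 H) (x₀ y : H) {t : ℝ} (ht : 0 ≤ t) :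
    S.mild x₀ (fun _ => y) t = S.flow t x₀ + ∫ s in 0..t, S.flow s y := by
  rw [S.mild_eq_flow x₀ _ ht, intervalIntegral.integral_comp_sub_left (S.flow · y) t, sub_self,
    sub_zero]

variable [CompleteSpace H]

theorem hasDerivWithinAt_mild_const (S : C0Semigroup 𝕜 H) {A : H →ₗ.[𝕜] H} (hA : IsGenerator A S)
    (x : A.domain) (y : H) :
    HasDerivWithinAt (S.mild x fun _ => y) (A x + y) (Set.Ioi 0) 0 := by
  have hlim := ((hA _ _).1 (A.mem_graph x)).add
    (tendsto_inv_smul_integral_zero (S.continuous_flow_apply y))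
  rw [S.flow_of_nonpos le_rfl] at hlim
  rw [hasDerivWithinAt_iff_tendsto_slope' Set.self_notMem_Ioi]
  refine hlim.congr' ?_
  filter_upwards [self_mem_nhdsWithin] with t (ht : 0 < t)
  rw [slope_def_module, sub_zero, mild_zero, S.mild_const _ _ ht.le, S.flow_of_nonneg ht.le,
    add_sub_right_comm, smul_add]

section Integrability

variable {f : ℝ → H} {a b : ℝ}

theorem integrableOn_flow_sub (S : C0Semigroup 𝕜 H) (hf : IntegrableOn f (Set.Ioc a b)) :
    IntegrableOn (fun p : ℝ × ℝ => S.flow (p.1 - p.2) (f p.2)) (Set.Ioc a b ×ˢ Set.Ioc a b) := by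
  obtain ⟨M, -, hM⟩ := S.exists_norm_flow_le (b - a)
  have hmem : ∀ᵐ p : ℝ × ℝ ∂volume.restrict (Set.Ioc a b ×ˢ Set.Ioc a b),
      p ∈ Set.Ioc a b ×ˢ Set.Ioc a b :=
    ae_restrict_mem (measurableSet_Ioc.prod measurableSet_Ioc)
  rw [Measure.volume_eq_prod, ← Measure.prod_restrict] at hmem
  rw [IntegrableOn, Measure.volume_eq_prod, ← Measure.prod_restrict]
  refine Integrable.mono' ((hf.norm.const_mul M).comp_snd _) ?_ ?_
  · exact S.continuous_uncurry_flow.comp_aestronglyMeasurable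
      ((continuous_fst.sub continuous_snd).aestronglyMeasurable.prodMk
        hf.aestronglyMeasurable.comp_snd)
  · filter_upwards [hmem] with p hp
    exact hM _ (sub_le_sub hp.1.2 hp.2.1.le) _

theorem intervalIntegrable_flow_sub (S : C0Semigroup 𝕜 H) (hf : IntervalIntegrable f volume a b)
    (t : ℝ) : IntervalIntegrable (fun s => S.flow (t - s) (f s)) volume a b := by
  obtain ⟨M, -, hM⟩ := S.exists_norm_flow_le (t - min a b)
  rw [intervalIntegrable_iff] at hf ⊢
  refine Integrable.mono' (hf.norm.const_mul M) ?_ ?_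
  · exact S.continuous_uncurry_flow.comp_aestronglyMeasurable
      ((continuous_const.sub continuous_id).aestronglyMeasurable.prodMk hf.aestronglyMeasurable)
  · filter_upwards [ae_restrict_mem measurableSet_uIoc] with s hs
    exact hM _ (sub_le_sub_left hs.1.le t) _

end Integrability

theorem continuousOn_mild (S : C0Semigroup 𝕜 H) (x₀ : H) {f : ℝ → H} {τ : ℝ}
    (hf : IntervalIntegrable f volume 0 τ) : ContinuousOn (S.mild x₀ f) (Set.Icc 0 τ) := by
  rcases lt_or_ge τ 0 with hτ | hτ
  · simp [Set.Icc_eq_empty_of_lt hτ]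
  have hsplit : ∀ t ∈ Set.Icc 0 τ, S.mild x₀ f t =
      S.flow t x₀ + ((∫ s in 0..τ, S.flow (t - s) (f s)) + ∫ s in τ..t, f s) := fun t ht => by
    have hsub : Set.uIcc τ t ⊆ Set.uIcc 0 τ := by
      rw [Set.uIcc_of_ge ht.2, Set.uIcc_of_le hτ]
      exact Set.Icc_subset_Icc_left ht.1
    have hflow : ∫ s in τ..t, S.flow (t - s) (f s) = ∫ s in τ..t, f s := by
      refine intervalIntegral.integral_congr fun s hs => ?_
      rw [Set.uIcc_of_ge ht.2] at hs
      exact S.flow_of_nonpos (sub_nonpos.2 hs.1) _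
    rw [S.mild_eq_flow x₀ f ht.1, ← hflow, intervalIntegral.integral_add_adjacent_intervals
      (S.intervalIntegrable_flow_sub hf t)
      (S.intervalIntegrable_flow_sub (hf.mono_set hsub) t)]
  obtain ⟨M, -, hM⟩ := S.exists_norm_flow_le τ
  refine ContinuousOn.congr ?_ hsplit
  refine (S.continuous_flow_apply x₀).continuousOn.add (ContinuousOn.add (fun t _ => ?_) ?_)
  · refine intervalIntegral.continuousWithinAt_of_dominated_interval
      (Eventually.of_forall fun t => (S.intervalIntegrable_flow_sub hf t).def'.aestronglyMeasurable)
      ?_ (hf.norm.const_mul M) (Eventually.of_forall fun s _ =>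
        (S.continuous_flow (by fun_prop) continuous_const).continuousWithinAt)
    filter_upwards [self_mem_nhdsWithin] with t ht
    refine Eventually.of_forall fun s hs => hM _ ?_ _
    rw [Set.uIoc_of_le hτ] at hs
    linarith [hs.1, ht.2]
  · rw [← Set.uIcc_of_le hτ]
    exact intervalIntegral.continuousOn_primitive_interval' hf Set.right_mem_uIcc

theorem map_mild (S : C0Semigroup 𝕜 H) (x₀ : H) {f : ℝ → H} {t : ℝ} (ht : 0 ≤ t)
    (hf : IntervalIntegrable f volume 0 t) {L : H →L[ℝ] H}
    (hL : ∀ r, 0 ≤ r → ∀ y, S.flow r (L y) = L (S.flow r y)) :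
    L (S.mild x₀ f t) = S.mild (L x₀) (fun s => L (f s)) t := by
  rw [S.mild_eq_flow _ _ ht, S.mild_eq_flow _ _ ht, _root_.map_add, hL t ht,
    ← ContinuousLinearMap.intervalIntegral_comp_comm _ (S.intervalIntegrable_flow_sub hf t)]
  congr 1
  refine intervalIntegral.integral_congr fun s hs => ?_
  rw [Set.uIcc_of_le ht] at hs
  exact (hL _ (sub_nonneg.2 hs.2) _).symm

theorem integral_mild (S : C0Semigroup 𝕜 H) (x₀ : H) {f : ℝ → H} {t : ℝ} (ht : 0 ≤ t)
    (hf : IntervalIntegrable f volume 0 t) :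
    ∫ r in 0..t, S.mild x₀ f r =
      (∫ r in 0..t, S.flow r x₀) + ∫ s in 0..t, ∫ r in 0..(t - s), S.flow r (f s) := by
  have hconv : ContinuousOn (fun r => ∫ s in 0..r, S.flow (r - s) (f s)) (Set.uIcc 0 t) := by
    rw [Set.uIcc_of_le ht]
    refine (S.continuousOn_mild 0 hf).congr fun r hr => ?_
    rw [S.mild_eq_flow 0 f hr.1, _root_.map_zero, zero_add]
  have hmild : ∫ r in 0..t, S.mild x₀ f r =
      ∫ r in 0..t, (S.flow r x₀ + ∫ s in 0..r, S.flow (r - s) (f s)) :=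
    intervalIntegral.integral_congr fun r hr =>
      S.mild_eq_flow x₀ f (by rw [Set.uIcc_of_le ht] at hr; exact hr.1)
  rw [hmild, intervalIntegral.integral_add
    ((S.continuous_flow_apply x₀).intervalIntegrable 0 t) hconv.intervalIntegrable,
    integral_integral_triangle (F := fun r s => S.flow (r - s) (f s)) ht
      (S.integrableOn_flow_sub ((intervalIntegrable_iff_integrableOn_Ioc_of_le ht).1 hf))]
  congr 1
  refine intervalIntegral.integral_congr fun s _ => ?_
  simpa only [sub_self] using
    intervalIntegral.integral_comp_sub_right (a := s) (b := t) (S.flow · (f s)) s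

theorem intervalIntegrable_diffQuot_mild (S : C0Semigroup 𝕜 H) (x₀ : H) {f : ℝ → H} {h t : ℝ}
    (ht : 0 ≤ t) (hf : IntervalIntegrable f volume 0 t) :
    IntervalIntegrable (fun s => S.diffQuot h (S.mild x₀ f s)) volume 0 t := by
  refine ContinuousOn.intervalIntegrable ?_
  rw [Set.uIcc_of_le ht]
  exact (S.diffQuot h).continuous.comp_continuousOn (S.continuousOn_mild x₀ hf)

theorem intervalIntegrable_deriv_avg_mild (S : C0Semigroup 𝕜 H) (x₀ : H) {f : ℝ → H} {h t : ℝ}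
    (ht : 0 ≤ t) (hf : IntervalIntegrable f volume 0 t) :
    IntervalIntegrable (fun s => S.diffQuot h (S.mild x₀ f s) + S.avg h (f s)) volume 0 t :=
  (S.intervalIntegrable_diffQuot_mild x₀ ht hf).add
    ⟨(S.avg h).integrable_comp hf.1, (S.avg h).integrable_comp hf.2⟩

theorem avg_mild (S : C0Semigroup 𝕜 H) (x₀ : H) {f : ℝ → H} {h t : ℝ} (hh : 0 < h) (ht : 0 ≤ t)
    (hf : IntervalIntegrable f volume 0 t) :
    S.avg h (S.mild x₀ f t) =
      S.avg h x₀ + ∫ s in 0..t, (S.diffQuot h (S.mild x₀ f s) + S.avg h (f s)) := by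
  have hcomp (L : H →L[ℝ] H) : IntervalIntegrable (fun s => L (f s)) volume 0 t :=
    ⟨L.integrable_comp hf.1, L.integrable_comp hf.2⟩
  have hmild : ∫ s in 0..t, S.diffQuot h (S.mild x₀ f s) =
      ∫ s in 0..t, S.mild (S.diffQuot h x₀) (fun r => S.diffQuot h (f r)) s := by
    refine intervalIntegral.integral_congr fun s hs => ?_
    have hfs := hf.mono_set (Set.uIcc_subset_uIcc_left hs)
    rw [Set.uIcc_of_le ht] at hs
    exact S.map_mild x₀ hs.1 hfs fun r hr => S.flow_diffQuot_comm hr hh.le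
  have hinner : ∫ s in 0..t, ∫ r in 0..(t - s), S.flow r (S.diffQuot h (f s)) =
      ∫ s in 0..t, (S.flow (t - s) (S.avg h (f s)) - S.avg h (f s)) := by
    refine intervalIntegral.integral_congr fun s hs => ?_
    rw [Set.uIcc_of_le ht] at hs
    simp only [S.flow_avg (sub_nonneg.2 hs.2) hh, add_sub_cancel_left]
  rw [S.map_mild x₀ ht hf fun r hr => S.flow_avg_comm hr hh.le, S.mild_eq_flow _ _ ht,
    S.flow_avg ht hh,
    intervalIntegral.integral_add (S.intervalIntegrable_diffQuot_mild x₀ ht hf) (hcomp _), hmild,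
    S.integral_mild _ ht (hcomp _), hinner,
    intervalIntegral.integral_sub (S.intervalIntegrable_flow_sub (hcomp _) t) (hcomp _)]
  abel

end C0Semigroup

/-! ### Dissipation inequalities -/

theorem intervalIntegrable_const_mul_one_add_norm_sq {U : Type*} [NormedAddCommGroup U]
    {u : ℝ → U} {a b : ℝ} (hu : MemLp u 2 (volume.restrict (Set.uIoc a b))) (c : ℝ) :
    IntervalIntegrable (fun t => c * (1 + ‖u t‖ ^ 2)) volume a b :=
  (intervalIntegrable_const.add
    (intervalIntegrable_iff.2 (hu.integrable_norm_pow two_ne_zero))).const_mul c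

/-- A rate `s x u`, for instance a running cost, that is jointly continuous and grows at most
quadratically in `u`, locally uniformly in `x`: it can be integrated along a continuous
trajectory `x` and a square integrable control `u`. -/
structure IsQuadraticRate {X U : Type*} [TopologicalSpace X] [NormedAddCommGroup U]
    (s : X → U → ℝ) : Prop where
  continuous : Continuous fun p : X × U => s p.1 p.2
  growth : ∀ K : Set X, IsCompact K → ∃ c, ∀ x ∈ K, ∀ u, |s x u| ≤ c * (1 + ‖u‖ ^ 2)

namespace IsQuadraticRate

section Constructions

variable {X Y U : Type*} [TopologicalSpace X] [TopologicalSpace Y] [NormedAddCommGroup U]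
  {s s' : X → U → ℝ}

theorem add (hs : IsQuadraticRate s) (hs' : IsQuadraticRate s') :
    IsQuadraticRate fun x u => s x u + s' x u where
  continuous := hs.continuous.add hs'.continuous
  growth K hK := by
    obtain ⟨c, hc⟩ := hs.growth K hK
    obtain ⟨c', hc'⟩ := hs'.growth K hK
    refine ⟨c + c', fun x hx u => (abs_add_le _ _).trans ?_⟩
    rw [add_mul]
    exact add_le_add (hc x hx u) (hc' x hx u)

theorem comp_continuous (hs : IsQuadraticRate s) {φ : Y → X} (hφ : Continuous φ) :
    IsQuadraticRate fun y u => s (φ y) u where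
  continuous := hs.continuous.comp (by fun_prop : Continuous fun p : Y × U => (φ p.1, p.2))
  growth K hK := by
    obtain ⟨c, hc⟩ := hs.growth _ (hK.image hφ)
    exact ⟨c, fun y hy => hc _ (Set.mem_image_of_mem φ hy)⟩

end Constructions

theorem of_continuous {X U : Type*} [TopologicalSpace X] [NormedAddCommGroup U] {φ : X → ℝ}
    (hφ : Continuous φ) : IsQuadraticRate fun x (_ : U) => φ x where
  continuous := hφ.comp continuous_fst
  growth K hK := by
    obtain ⟨c, hc⟩ := hK.exists_bound_of_continuousOn hφ.continuousOn
    refine ⟨c, fun x hx u => (hc x hx).trans (le_mul_of_one_le_right ?_ ?_)⟩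
    · exact (norm_nonneg _).trans (hc x hx)
    · exact le_add_of_nonneg_right (sq_nonneg _)

theorem of_linear {X 𝕜 U E : Type*} [TopologicalSpace X] [RCLike 𝕜] [NormedAddCommGroup U]
    [NormedSpace 𝕜 U] [NormedAddCommGroup E] [NormedSpace ℝ E] [NormedSpace 𝕜 E] [CompleteSpace E]
    (B : U →L[𝕜] E) {L : X → E →L[ℝ] ℝ} (hL : Continuous fun p : X × E => L p.1 p.2) :
    IsQuadraticRate fun x u => L x (B u) where
  continuous := hL.comp (by fun_prop : Continuous fun p : X × U => (p.1, B p.2))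
  growth K hK := by
    obtain ⟨c, hc⟩ := banach_steinhaus (g := fun x : K => L x) fun y => by
      obtain ⟨c, hc⟩ := hK.exists_bound_of_continuousOn
        (hL.comp (continuous_id.prodMk continuous_const : Continuous fun x => (x, y))).continuousOn
      exact ⟨c, fun x => hc x x.2⟩
    refine ⟨c * ‖B‖, fun x hx u => ?_⟩
    have hc0 : 0 ≤ c := (norm_nonneg _).trans (hc ⟨x, hx⟩)
    calc ‖L x (B u)‖ ≤ c * ‖B u‖ := (L x).le_of_opNorm_le (hc ⟨x, hx⟩) _
      _ ≤ c * (‖B‖ * ‖u‖) := by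
        gcongr
        exact B.le_opNorm u
      _ ≤ c * ‖B‖ * (1 + ‖u‖ ^ 2) := by
        rw [← mul_assoc]
        gcongr
        nlinarith [sq_nonneg (‖u‖ - 1)]

section Integral

variable {X U : Type*} [TopologicalSpace X] [TopologicalSpace.PseudoMetrizableSpace X]
  [NormedAddCommGroup U] {x : ℝ → X} {u : ℝ → U} {a b : ℝ}

theorem aestronglyMeasurable {s : X → U → ℝ} (hs : IsQuadraticRate s)
    (hx : ContinuousOn x (Set.uIcc a b)) (hu : MemLp u 2 (volume.restrict (Set.uIoc a b))) :
    AEStronglyMeasurable (fun t => s (x t) (u t)) (volume.restrict (Set.uIoc a b)) :=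
  hs.continuous.comp_aestronglyMeasurable
    (((hx.mono Set.uIoc_subset_uIcc).aestronglyMeasurable measurableSet_uIoc).prodMk
      hu.aestronglyMeasurable)

theorem intervalIntegrable {s : X → U → ℝ} (hs : IsQuadraticRate s)
    (hx : ContinuousOn x (Set.uIcc a b)) (hu : MemLp u 2 (volume.restrict (Set.uIoc a b))) :
    IntervalIntegrable (fun t => s (x t) (u t)) volume a b := by
  obtain ⟨c, hc⟩ := hs.growth _ (isCompact_uIcc.image_of_continuousOn hx)
  refine (intervalIntegrable_const_mul_one_add_norm_sq hu c).mono_fun'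
    (hs.aestronglyMeasurable hx hu) ?_
  filter_upwards [ae_restrict_mem measurableSet_uIoc] with t ht
  exact hc _ (Set.mem_image_of_mem x (Set.uIoc_subset_uIcc ht)) _

theorem continuous_integral {s : ℝ × X → U → ℝ} (hs : IsQuadraticRate s)
    (hx : ContinuousOn x (Set.uIcc a b)) (hu : MemLp u 2 (volume.restrict (Set.uIoc a b))) :
    Continuous fun h => ∫ t in a..b, s (h, x t) (u t) := by
  refine continuous_iff_continuousAt.2 fun h₀ => ?_
  obtain ⟨c, hc⟩ := hs.growth _ ((isCompact_closedBall h₀ 1).prod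
    (isCompact_uIcc.image_of_continuousOn hx))
  refine intervalIntegral.continuousAt_of_dominated_interval (Eventually.of_forall fun h =>
    hs.aestronglyMeasurable (continuousOn_const.prodMk hx) hu) ?_
    (intervalIntegrable_const_mul_one_add_norm_sq hu c) (Eventually.of_forall fun t _ => ?_)
  · filter_upwards [Metric.closedBall_mem_nhds h₀ one_pos] with h hh
    exact Eventually.of_forall fun t ht =>
      hc _ ⟨hh, Set.mem_image_of_mem x (Set.uIoc_subset_uIcc ht)⟩ _
  · exact (hs.continuous.comp (by fun_prop : Continuous fun h : ℝ => ((h, x t), u t))).continuousAt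

end Integral

end IsQuadraticRate

theorem intervalIntegrable_fderiv_apply {E : Type*} [NormedAddCommGroup E] [NormedSpace ℝ E]
    {V : E → ℝ} (hV : ContDiff ℝ 1 V) {x w : ℝ → E} {a b : ℝ} (hx : ContinuousOn x (Set.uIcc a b))
    (hw : IntervalIntegrable w volume a b) :
    IntervalIntegrable (fun t => fderiv ℝ V (x t) (w t)) volume a b := by
  have hV' : ContinuousOn (fun t => fderiv ℝ V (x t)) (Set.uIcc a b) :=
    (hV.continuous_fderiv one_ne_zero).comp_continuousOn hx
  obtain ⟨N, hN⟩ := isCompact_uIcc.exists_bound_of_continuousOn hV'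
  refine (hw.norm.const_mul N).mono_fun' ?_ ?_
  · exact (hV.continuous_fderiv_apply one_ne_zero).comp_aestronglyMeasurable
      (((hx.mono Set.uIoc_subset_uIcc).aestronglyMeasurable measurableSet_uIoc).prodMk
        hw.def'.aestronglyMeasurable)
  · filter_upwards [ae_restrict_mem measurableSet_uIoc] with t ht
    exact ContinuousLinearMap.le_of_opNorm_le _ (hN t (Set.uIoc_subset_uIcc ht)) _

section IsL2Loc

variable {U : Type*} [NormedAddCommGroup U] {u : ℝ → U}

theorem IsL2Loc.memLp_uIoc (hu : IsL2Loc u) {a b : ℝ} (ha : 0 ≤ a) (hb : 0 ≤ b) :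
    MemLp u 2 (volume.restrict (Set.uIoc a b)) := by
  refine (hu (max a b)).mono_measure (Measure.restrict_mono_set _ fun t ht => ?_)
  exact ⟨(le_min ha hb).trans ht.1.le, ht.2⟩

theorem IsL2Loc.intervalIntegrable_clm {𝕜 E : Type*} [NontriviallyNormedField 𝕜] [NormedSpace 𝕜 U]
    [NormedAddCommGroup E] [NormedSpace 𝕜 E] (hu : IsL2Loc u) (B : U →L[𝕜] E) {τ : ℝ}
    (hτ : 0 ≤ τ) : IntervalIntegrable (fun t => B (u t)) volume 0 τ :=
  (intervalIntegrable_iff_integrableOn_Icc_of_le hτ).2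
    (B.integrable_comp ((hu τ).integrable one_le_two))

theorem isL2Loc_const (v : U) : IsL2Loc fun _ => v := fun _ => memLp_const v

end IsL2Loc

namespace C0Semigroup

variable {𝕜 H U : Type*} [RCLike 𝕜] [NormedAddCommGroup H] [InnerProductSpace 𝕜 H]
  [NormedSpace ℝ H] [IsScalarTower ℝ 𝕜 H] [CompleteSpace H]
  [NormedAddCommGroup U] [NormedSpace 𝕜 U]
  {V : H → ℝ} {s : H → U → ℝ} {B : U →L[𝕜] H} {u : ℝ → U} {A : H →ₗ.[𝕜] H}

/-- A bound for the derivative of `V` along the averaged trajectory `avg h x` of `x' = A x + B u`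
when `V` dissipates at the rate `s`. The averaged trajectory is driven by `avg h (B u)` instead of
`B u`, which accounts for the second term. -/
noncomputable def avgRate (S : C0Semigroup 𝕜 H) (V : H → ℝ) (B : U →L[𝕜] H) (s : H → U → ℝ)
    (p : ℝ × H) (u : U) : ℝ :=
  s (S.avg p.1 p.2) u + fderiv ℝ V (S.avg p.1 p.2) (S.avg p.1 (B u) - B u)

theorem avgRate_zero (S : C0Semigroup 𝕜 H) (x : H) (u : U) : S.avgRate V B s (0, x) u = s x u := by
  simp [avgRate, avg_zero_apply]

theorem isQuadraticRate_avgRate (S : C0Semigroup 𝕜 H) (hV : ContDiff ℝ 1 V)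
    (hs : IsQuadraticRate s) : IsQuadraticRate (S.avgRate V B s) := by
  have hV' := hV.continuous_fderiv one_ne_zero
  have havg {φ : (ℝ × H) × H → H} (hφ : Continuous φ) : Continuous fun q => S.avg q.1.1 (φ q) :=
    S.continuous_avg.comp (by fun_prop : Continuous fun q => (q.1.1, φ q))
  let L (p : ℝ × H) : H →L[ℝ] ℝ := fderiv ℝ V (S.avg p.1 p.2) ∘L (S.avg p.1 - 1)
  have hL : Continuous fun q : (ℝ × H) × H => L q.1 q.2 :=
    (hV'.comp (havg (by fun_prop))).clm_apply ((havg continuous_snd).sub continuous_snd)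
  have hrate := (hs.comp_continuous S.continuous_avg).add (.of_linear B hL)
  simp only [L, ContinuousLinearMap.comp_apply, sub_apply, one_apply_eq_self] at hrate
  exact hrate

theorem fderiv_avg_le_avgRate (S : C0Semigroup 𝕜 H) (hA : IsGenerator A S)
    (hdiss : ∀ (x : A.domain) u, fderiv ℝ V x (A x + B u) ≤ s x u) {h : ℝ} (hh : 0 < h) (y : H)
    (u : U) :
    fderiv ℝ V (S.avg h y) (S.diffQuot h y + S.avg h (B u)) ≤ S.avgRate V B s (h, y) u := by
  obtain ⟨x, hx, hAx⟩ := (LinearPMap.mem_graph_iff _).1 (S.avg_mem_graph hA hh y)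
  have hle := hdiss x u
  rw [hx, hAx] at hle
  calc fderiv ℝ V (S.avg h y) (S.diffQuot h y + S.avg h (B u))
      = fderiv ℝ V (S.avg h y) (S.diffQuot h y + B u) +
          fderiv ℝ V (S.avg h y) (S.avg h (B u) - B u) := by
        rw [← _root_.map_add, add_add_sub_cancel]
    _ ≤ S.avgRate V B s (h, y) u := by
        exact add_le_add_left hle _

theorem avg_mild_eq_add_integral (S : C0Semigroup 𝕜 H) (x₀ : H) {f : ℝ → H} {h t₁ t : ℝ}
    (hh : 0 < h) (ht₁ : 0 ≤ t₁) (ht : t₁ ≤ t) (hf : IntervalIntegrable f volume 0 t) :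
    S.avg h (S.mild x₀ f t) = S.avg h (S.mild x₀ f t₁) +
      ∫ s in t₁..t, (S.diffQuot h (S.mild x₀ f s) + S.avg h (f s)) := by
  have ht0 := ht₁.trans ht
  have hw := S.intervalIntegrable_deriv_avg_mild x₀ (h := h) ht0 hf
  have hsub : Set.uIcc 0 t₁ ⊆ Set.uIcc 0 t := by
    rw [Set.uIcc_of_le ht₁, Set.uIcc_of_le ht0]
    exact Set.Icc_subset_Icc_right ht
  rw [S.avg_mild x₀ hh ht0 hf, S.avg_mild x₀ hh ht₁ (hf.mono_set hsub), add_assoc,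
    intervalIntegral.integral_add_adjacent_intervals (hw.mono_set hsub)
      (hw.mono_set (Set.uIcc_subset_uIcc_right (hsub Set.right_mem_uIcc)))]

theorem sub_le_integral_avgRate (S : C0Semigroup 𝕜 H) (hA : IsGenerator A S) (hV : ContDiff ℝ 1 V)
    (hs : IsQuadraticRate s) (hdiss : ∀ (x : A.domain) u, fderiv ℝ V x (A x + B u) ≤ s x u)
    (x₀ : H) (hu : IsL2Loc u) {h t₁ t₂ : ℝ} (hh : 0 < h) (ht₁ : 0 ≤ t₁) (ht : t₁ ≤ t₂) :
    V (S.avg h (S.mild x₀ (fun t => B (u t)) t₂)) - V (S.avg h (S.mild x₀ (fun t => B (u t)) t₁)) ≤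
      ∫ t in t₁..t₂, S.avgRate V B s (h, S.mild x₀ (fun t => B (u t)) t) (u t) := by
  set m := S.mild x₀ fun t => B (u t)
  set w := fun t => S.diffQuot h (m t) + S.avg h (B (u t))
  have ht₂ := ht₁.trans ht
  have hf {τ : ℝ} (hτ : 0 ≤ τ) := hu.intervalIntegrable_clm B hτ
  have hm : ContinuousOn m (Set.uIcc t₁ t₂) := by
    rw [Set.uIcc_of_le ht]
    exact (S.continuousOn_mild x₀ (hf ht₂)).mono (Set.Icc_subset_Icc_left ht₁)
  have hw : IntervalIntegrable w volume t₁ t₂ :=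
    (S.intervalIntegrable_deriv_avg_mild x₀ ht₂ (hf ht₂)).mono_set
      (Set.uIcc_subset_uIcc_right (Set.mem_uIcc_of_le ht₁ ht))
  have htraj : ∀ t ∈ Set.Icc t₁ t₂, S.avg h (m t) = S.avg h (m t₁) + ∫ s in t₁..t, w s :=
    fun t ht' => S.avg_mild_eq_add_integral x₀ hh ht₁ ht'.1 (hf (ht₁.trans ht'.1))
  calc V (S.avg h (m t₂)) - V (S.avg h (m t₁))
      = ∫ t in t₁..t₂, fderiv ℝ V (S.avg h (m t₁) + ∫ s in t₁..t, w s) (w t) := by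
        rw [htraj t₂ ⟨ht, le_rfl⟩, sub_eq_integral_fderiv_comp_primitive hV hw]
    _ = ∫ t in t₁..t₂, fderiv ℝ V (S.avg h (m t)) (w t) := by
        refine intervalIntegral.integral_congr fun t ht' => ?_
        rw [Set.uIcc_of_le ht] at ht'
        simp only [htraj t ht']
    _ ≤ ∫ t in t₁..t₂, S.avgRate V B s (h, m t) (u t) :=
        intervalIntegral.integral_mono_on ht
          (intervalIntegrable_fderiv_apply hV ((S.avg h).continuous.comp_continuousOn hm) hw)
          ((S.isQuadraticRate_avgRate hV hs).intervalIntegrable (continuousOn_const.prodMk hm)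
            (hu.memLp_uIoc ht₁ ht₂))
          fun t _ => S.fderiv_avg_le_avgRate hA hdiss hh (m t) (u t)

theorem sub_le_integral_of_fderiv_le (S : C0Semigroup 𝕜 H) (hA : IsGenerator A S)
    (hV : ContDiff ℝ 1 V) (hs : IsQuadraticRate s)
    (hdiss : ∀ (x : A.domain) u, fderiv ℝ V x (A x + B u) ≤ s x u)
    (x₀ : H) (hu : IsL2Loc u) {t₁ t₂ : ℝ} (ht₁ : 0 ≤ t₁) (ht : t₁ ≤ t₂) :
    V (S.mild x₀ (fun t => B (u t)) t₂) - V (S.mild x₀ (fun t => B (u t)) t₁) ≤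
      ∫ t in t₁..t₂, s (S.mild x₀ (fun t => B (u t)) t) (u t) := by
  set m := S.mild x₀ fun t => B (u t)
  have ht₂ := ht₁.trans ht
  have hm : ContinuousOn m (Set.uIcc t₁ t₂) := by
    rw [Set.uIcc_of_le ht]
    exact (S.continuousOn_mild x₀ (hu.intervalIntegrable_clm B ht₂)).mono
      (Set.Icc_subset_Icc_left ht₁)
  have hVavg (y : H) : Tendsto (fun h => V (S.avg h y)) (𝓝[>] 0) (𝓝 (V y)) :=
    (hV.continuous.tendsto y).comp (S.tendsto_avg_zero y)
  have hrate := (((S.isQuadraticRate_avgRate (B := B) hV hs).continuous_integral hm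
    (hu.memLp_uIoc ht₁ ht₂)).tendsto 0).mono_left (nhdsWithin_le_nhds (s := Set.Ioi 0))
  simp only [avgRate_zero] at hrate
  refine le_of_tendsto_of_tendsto ((hVavg _).sub (hVavg _)) hrate ?_
  filter_upwards [self_mem_nhdsWithin] with h hh
  exact S.sub_le_integral_avgRate hA hV hs hdiss x₀ hu hh ht₁ ht

theorem fderiv_le_of_sub_le_integral (S : C0Semigroup 𝕜 H) (hA : IsGenerator A S)
    (hV : Differentiable ℝ V) (hs : Continuous fun p : H × U => s p.1 p.2) (x : A.domain) (u : U)
    (hint : ∀ t, 0 < t → V (S.mild x (fun _ => B u) t) - V x ≤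
      ∫ r in 0..t, s (S.mild x (fun _ => B u) r) u) :
    fderiv ℝ V x (A x + B u) ≤ s x u := by
  set m := S.mild x fun _ => B u
  have hm0 : m 0 = x := S.mild_zero _ _
  have hderiv : HasDerivWithinAt (V ∘ m) (fderiv ℝ V x (A x + B u)) (Set.Ioi 0) 0 := by
    refine HasFDerivAt.comp_hasDerivWithinAt 0 ?_ (S.hasDerivWithinAt_mild_const hA x (B u))
    rw [hm0]
    exact (hV x).hasFDerivAt
  have hcont : ContinuousOn (fun t => s (m t) u) (Set.Icc 0 1) :=
    hs.comp_continuousOn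
      ((S.continuousOn_mild x intervalIntegrable_const).prodMk continuousOn_const)
  simpa only [hm0] using le_of_forall_sub_le_integral one_pos hderiv hcont fun t ht => by
    simpa only [Function.comp_apply, hm0] using hint t ht.1

end C0Semigroup

namespace OCP

variable {𝕜 H U Y Z : Type*} [RCLike 𝕜]
  [NormedAddCommGroup H] [InnerProductSpace 𝕜 H] [NormedSpace ℝ H]
  [NormedAddCommGroup U] [InnerProductSpace 𝕜 U]
  [NormedAddCommGroup Y] [InnerProductSpace 𝕜 Y]
  [NormedAddCommGroup Z] [InnerProductSpace 𝕜 Z]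

theorem isQuadraticRate_cost (P : OCP 𝕜 H U Y Z) : IsQuadraticRate P.cost := by
  have hstate : Continuous fun x => ‖P.C x‖ ^ 2 + 2 * RCLike.re (inner 𝕜 P.z x) := by fun_prop
  have hcontrol : IsQuadraticRate fun (_ : H) u =>
      ‖P.K u‖ ^ 2 + 2 * RCLike.re (inner 𝕜 P.v u) := by
    refine ⟨by fun_prop, fun _ _ => ⟨‖P.K‖ ^ 2 + ‖P.v‖, fun _ _ u => ?_⟩⟩
    have hK : ‖P.K u‖ ^ 2 ≤ (‖P.K‖ * ‖u‖) ^ 2 := by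
      gcongr
      exact P.K.le_opNorm u
    have hv : |RCLike.re (inner 𝕜 P.v u)| ≤ ‖P.v‖ * ‖u‖ :=
      (RCLike.abs_re_le_norm _).trans (norm_inner_le_norm _ _)
    calc |‖P.K u‖ ^ 2 + 2 * RCLike.re (inner 𝕜 P.v u)|
        ≤ ‖P.K u‖ ^ 2 + 2 * |RCLike.re (inner 𝕜 P.v u)| := by
          refine (abs_add_le _ _).trans_eq ?_
          rw [abs_of_nonneg (sq_nonneg _), abs_mul, abs_two]
      _ ≤ ‖P.K‖ ^ 2 * ‖u‖ ^ 2 + ‖P.v‖ * (2 * ‖u‖) := by linarith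
      _ ≤ (‖P.K‖ ^ 2 + ‖P.v‖) * (1 + ‖u‖ ^ 2) := by
        nlinarith [sq_nonneg ‖P.K‖, mul_nonneg (norm_nonneg P.v) (sq_nonneg (‖u‖ - 1))]
  convert (IsQuadraticRate.of_continuous hstate).add hcontrol using 3
  simp only [cost]
  ring

theorem isQuadraticRate_dissipation (P : OCP 𝕜 H U Y Z) (xe : H) (ue : U) {α : ℝ≥0 → ℝ≥0}
    (hα : Continuous α) :
    IsQuadraticRate fun x u => P.cost x u - P.cost xe ue - (α ‖x - xe‖₊ : ℝ) := by
  have hshift : Continuous fun x => -P.cost xe ue - (α ‖x - xe‖₊ : ℝ) := by fun_prop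
  convert P.isQuadraticRate_cost.add (.of_continuous hshift) using 3
  ring

end OCP

end LQ

theorem lemma3p3_general {𝕜 H U : Type*} [RCLike 𝕜]
    [NormedAddCommGroup H] [InnerProductSpace 𝕜 H] [CompleteSpace H]
    [NormedSpace ℝ H] [IsScalarTower ℝ 𝕜 H] [NormedAddCommGroup U] [NormedSpace 𝕜 U]
    {A : H →ₗ.[𝕜] H} {S : LQ.C0Semigroup 𝕜 H} (hA : LQ.IsGenerator A S) (B : U →L[𝕜] H)
    {V : H → ℝ} (hV : ContDiff ℝ 1 V) {s : H → U → ℝ} (hs : LQ.IsQuadraticRate s) :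
    (∀ (x : A.domain) (u : U), fderiv ℝ V x (A x + B u) ≤ s x u) ↔
      ∀ (x₀ : H) (u : ℝ → U), LQ.IsL2Loc u → ∀ t₁ t₂ : ℝ, 0 ≤ t₁ → t₁ < t₂ →
        V (S.mild x₀ (fun t => B (u t)) t₂) - V (S.mild x₀ (fun t => B (u t)) t₁) ≤
          ∫ t in t₁..t₂, s (S.mild x₀ (fun r => B (u r)) t) (u t) := by
  refine ⟨fun hdiss x₀ u hu t₁ t₂ ht₁ ht =>
    S.sub_le_integral_of_fderiv_le hA hV hs hdiss x₀ hu ht₁ ht.le, fun hint x u => ?_⟩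
  refine S.fderiv_le_of_sub_le_integral hA (hV.differentiable one_ne_zero) hs.continuous x u
    fun t ht => ?_
  simpa only [S.mild_zero] using hint x (fun _ => u) (LQ.isL2Loc_const u) 0 t le_rfl ht

theorem lemma3p3 {𝕜 H U Y Z : Type*} [RCLike 𝕜]
    [NormedAddCommGroup H] [InnerProductSpace 𝕜 H] [CompleteSpace H]
    [NormedSpace ℝ H] [IsScalarTower ℝ 𝕜 H]
    [NormedAddCommGroup U] [InnerProductSpace 𝕜 U] [CompleteSpace U]
    [NormedAddCommGroup Y] [InnerProductSpace 𝕜 Y] [CompleteSpace Y]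
    [NormedAddCommGroup Z] [InnerProductSpace 𝕜 Z] [CompleteSpace Z]
    (P : LQ.OCP 𝕜 H U Y Z) (xe : H) (ue : U) (he : P.IsControlledEquilibrium xe ue)
    (V : H → ℝ) (hV : LQ.IsStorageFunction V) (α : ℝ≥0 → ℝ≥0) (hα : LQ.ClassK α) :
    P.IsStrictlyPreDissipativeWith xe ue V α ↔
      ∀ (x₀ : H) (u : ℝ → U), LQ.IsL2Loc u → ∀ t₁ t₂ : ℝ, 0 ≤ t₁ → t₁ < t₂ →
        V (P.mildSolution u x₀ t₂) - V (P.mildSolution u x₀ t₁) ≤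
          ∫ t in t₁..t₂, (P.cost (P.mildSolution u x₀ t) (u t) - P.cost xe ue
            - (α ‖P.mildSolution u x₀ t - xe‖₊ : ℝ)) := by
  have key := lemma3p3_general P.isGenerator P.B hV
    (P.isQuadraticRate_dissipation xe ue hα.continuous)
  exact ⟨fun h => key.1 h.dissipation, fun h => ⟨he, hV, hα, key.2 h⟩⟩
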